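/- Let $K$ be a closed connected subgroup (a subtorus) of $T^N=\{\zeta\in\mathbb{C}^N : |\zeta_i|=1\}$ with Lie algebra $k\subset t^N=\mathbb{R}^N$ (where $\mathrm{Exp}(X)=(e^{2\pi\sqrt{-1}X_i})_i$), let $\iota^*u_i\in k^*$ be the restriction to $k$ of the $i$-th coordinate function, and let $K_{\mathbb{C}}=K\,\mathrm{Exp}(\sqrt{-1}k)\subset(\mathbb{C}^\times)^N$ be the complexification of $K$. These groups act on $\mathbb{H}^N\cong\mathbb{C}^N\times\mathbb{C}^N$ by $(z,w)\zeta=(z\zeta,w\zeta^{-1})$. Put $$\mu_1(z,w)=\pi\sum_{i=1}^N(|z_i|^2-|w_i|^2)\,\iota^*u_i\in k^*,\qquad \mu_{\mathbb{C}}(z,w)=-2\pi\sqrt{-1}\sum_{i=1}^N z_iw_i\,\iota^*u_i\in k_{\mathbb{C}}^*.$$ For $(\alpha,\beta)\in k^*\times k_{\mathbb{C}}^*$ let $X(\alpha,\beta)=\bigl(\mu_1^{-1}(\alpha)\cap\mu_{\mathbb{C}}^{-1}(\beta)\bigr)/K$ be the toric hyperkähler variety, with the quotient topology. A point $(z,w)\in\mu_{\mathbb{C}}^{-1}(\beta)$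 is $\alpha$-semi-stable if $$\alpha\in\sum_{i=1}^N\mathbb{R}_{\ge0}|z_i|^2\,\iota^*u_i+\sum_{i=1}^N\mathbb{R}_{\ge0}|w_i|^2\,(-\iota^*u_i).$$ Let $\mu_{\mathbb{C}}^{-1}(\beta)^{\alpha-ss}$ be the set of these points, so that $\mu_{\mathbb{C}}^{-1}(\beta)^{0-ss}=\mu_{\mathbb{C}}^{-1}(\beta)$. Let $\mu_{\mathbb{C}}^{-1}(\beta)^{\alpha-ss}//K_{\mathbb{C}}$ be its categorical quotient: the quotient, with the quotient topology, by the equivalence relation generated by identifying two points whenever the closures of their $K_{\mathbb{C}}$-orbits in $\mu_{\mathbb{C}}^{-1}(\beta)^{\alpha-ss}$ meet. A function on an open subset of it is holomorphic if its pull-back to $\mu_{\mathbb{C}}^{-1}(\beta)^{\alpha-ss}$ is locally the restriction of a holomorphic function on an open subset of $\mathbb{C}^N\times\mathbb{C}^N$. The inclusion $\mu_1^{-1}(\alpha)\cap\mu_{\mathbb{C}}^{-1}(\beta)\subset\mu_{\mathbb{C}}^{-1}(\beta)^{\alpha-ss}$ induces the natural map $X(\alpha,\beta)\to\mu_{\mathbb{C}}^{-1}(\beta)^{\alpha-ss}//K_{\mathbb{C}}$,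 through which $(X(\alpha,\beta),I_1)$ is identified with this quotient. Then, for every $(\alpha,\beta)\in k^*\times k_{\mathbb{C}}^*$, the natural map $$\mu_{\mathbb{C}}^{-1}(\beta)^{\alpha-ss}//K_{\mathbb{C}}\to\mu_{\mathbb{C}}^{-1}(\beta)//K_{\mathbb{C}}$$ induced by the inclusion $\mu_{\mathbb{C}}^{-1}(\beta)^{\alpha-ss}\subset\mu_{\mathbb{C}}^{-1}(\beta)$ is a morphism (it is continuous and pulls holomorphic functions on open sets back to holomorphic functions), and it is proper and surjective. Moreover, there is exactly one map $\pi_1\colon X(\alpha,\beta)\to X(0,\beta)$ that corresponds to it under the natural maps from $X(\alpha,\beta)$ and $X(0,\beta)$ to these quotients, and the natural morphism $\pi_1\colon(X(\alpha,\beta),I_1)\to(X(0,\beta),I_1)$ so defined is proper and surjective. -/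

import Mathlib

namespace ToricHyperkahler

/-- The quaternionic vector space `ℍ^N`, with `ξ = z + w I₂` identified with
`(z, w) ∈ ℂ^N × ℂ^N`. The complex structure `I₁` is the standard one of `ℂ^N × ℂ^N`. -/
abbrev HN (N : ℕ) : Type := (Fin N → ℂ) × (Fin N → ℂ)

/-- The real torus `T^N`. -/
abbrev RealTorus (N : ℕ) : Type := Fin N → Circle

/-- The complex torus `(ℂ^×)^N`. -/
abbrev ComplexTorus (N : ℕ) : Type := Fin N → ℂˣ

variable {N : ℕ}

/-- The action `(z, w) ζ = (z ζ, w ζ⁻¹)` of the complex torus on `ℍ^N`. -/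
def act (ζ : ComplexTorus N) (p : HN N) : HN N :=
  (fun i => p.1 i * (ζ i : ℂ), fun i => p.2 i * ((ζ i)⁻¹ : ℂˣ))

theorem act_one (p : HN N) : act 1 p = p := by
  simp [act]

theorem act_mul (ζ ξ : ComplexTorus N) (p : HN N) : act (ζ * ξ) p = act ζ (act ξ p) := by
  ext i <;> simp [act] <;> ring

/-- The inclusion of the real torus `T^N` into the complex torus `(ℂ^×)^N`. -/
noncomputable def toComplexTorus : RealTorus N →* ComplexTorus N where
  toFun ζ := fun i => Circle.toUnits (ζ i)
  map_one' := by ext i; simp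
  map_mul' ζ ξ := by ext i; simp

/-- The exponential map `t^N = ℝ^N → T^N`, normalized so that its kernel is `ℤ^N`. -/
noncomputable def torusExp (X : Fin N → ℝ) : RealTorus N :=
  fun i => Circle.exp (2 * Real.pi * X i)

theorem torusExp_add (X Y : Fin N → ℝ) : torusExp (X + Y) = torusExp X * torusExp Y := by
  funext i
  simp only [torusExp, Pi.add_apply, Pi.mul_apply]
  rw [← Circle.exp_add]; congr 1; ring

theorem torusExp_zero : torusExp (0 : Fin N → ℝ) = 1 := by
  funext i; simp [torusExp]

/-- The Lie algebra `k ⊆ t^N = ℝ^N` of a subgroup `K` of `T^N`. -/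
noncomputable def lieAlg (K : Subgroup (RealTorus N)) : Submodule ℝ (Fin N → ℝ) where
  carrier := {X | ∀ t : ℝ, torusExp (t • X) ∈ K}
  zero_mem' := fun t => by
    rw [smul_zero, torusExp_zero]; exact K.one_mem
  add_mem' := fun {X Y} hX hY t => by
    rw [smul_add, torusExp_add]; exact K.mul_mem (hX t) (hY t)
  smul_mem' := fun c X hX t => by
    rw [smul_smul]; exact hX (t * c)

/-- `Exp (√-1 Y) ∈ (ℂ^×)^N` for `Y ∈ t^N = ℝ^N`; its `i`-th entry is
`exp (2 π √-1 · √-1 Y_i) = exp (-2 π Y_i)`. -/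
noncomputable def imagExp (Y : Fin N → ℝ) : ComplexTorus N :=
  fun i => Units.mk0 (Complex.exp (2 * Real.pi * Complex.I * (Complex.I * Y i)))
    (Complex.exp_ne_zero _)

theorem imagExp_add (X Y : Fin N → ℝ) : imagExp (X + Y) = imagExp X * imagExp Y := by
  ext i
  simp only [imagExp, Pi.add_apply, Pi.mul_apply, Units.val_mul, Units.val_mk0]
  rw [← Complex.exp_add]; congr 1; push_cast; ring

theorem imagExp_zero : imagExp (0 : Fin N → ℝ) = 1 := by
  ext i; simp [imagExp]

/-- The complexification `K_ℂ = K · Exp (√-1 k) ⊆ (ℂ^×)^N` of `K ⊆ T^N`. -/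
noncomputable def complexification (K : Subgroup (RealTorus N)) : Subgroup (ComplexTorus N) where
  carrier := {ζ | ∃ g ∈ K, ∃ Y ∈ lieAlg K, ζ = toComplexTorus g * imagExp Y}
  one_mem' := ⟨1, K.one_mem, 0, (lieAlg K).zero_mem, by rw [imagExp_zero, map_one, one_mul]⟩
  mul_mem' := by
    rintro _ _ ⟨g, hg, Y, hY, rfl⟩ ⟨h, hh, Z, hZ, rfl⟩
    exact ⟨g * h, K.mul_mem hg hh, Y + Z, (lieAlg K).add_mem hY hZ, by
      rw [map_mul, imagExp_add, mul_mul_mul_comm]⟩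
  inv_mem' := by
    rintro _ ⟨g, hg, Y, hY, rfl⟩
    refine ⟨g⁻¹, K.inv_mem hg, -Y, (lieAlg K).neg_mem hY, ?_⟩
    have h : imagExp Y * imagExp (-Y) = 1 := by rw [← imagExp_add, add_neg_cancel, imagExp_zero]
    rw [map_inv, mul_inv, eq_inv_of_mul_eq_one_right h]

theorem toComplexTorus_mem {K : Subgroup (RealTorus N)} {g : RealTorus N} (hg : g ∈ K) :
    toComplexTorus g ∈ complexification K :=
  ⟨g, hg, 0, (lieAlg K).zero_mem, by rw [imagExp_zero, mul_one]⟩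

/-- The dual space `k^*`. -/
abbrev KDual (K : Subgroup (RealTorus N)) : Type := lieAlg K →ₗ[ℝ] ℝ

/-- The complexified dual space `k_ℂ^* = Hom_ℂ (k ⊗ ℂ, ℂ)`, that is, the space of real linear
maps `k → ℂ`. -/
abbrev KDualC (K : Subgroup (RealTorus N)) : Type := lieAlg K →ₗ[ℝ] ℂ

/-- `ι^* u_i ∈ k^*`, the restriction to `k` of the `i`-th coordinate function of `t^N = ℝ^N`. -/
noncomputable def weight (K : Subgroup (RealTorus N)) (i : Fin N) : KDual K :=
  (LinearMap.proj i : (Fin N → ℝ) →ₗ[ℝ] ℝ).comp (lieAlg K).subtype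

/-- The real moment map `μ₁ (z, w) = π ∑ (|z_i|² - |w_i|²) ι^* u_i`. -/
noncomputable def momentR (K : Subgroup (RealTorus N)) (p : HN N) : KDual K :=
  ∑ i, (Real.pi * (‖p.1 i‖ ^ 2 - ‖p.2 i‖ ^ 2)) • weight K i

/-- The complex moment map `μ_ℂ (z, w) = -2 π √-1 ∑ z_i w_i ι^* u_i`. -/
noncomputable def momentC (K : Subgroup (RealTorus N)) (p : HN N) : KDualC K :=
  ∑ i, (weight K i).smulRight (-2 * Real.pi * Complex.I * (p.1 i * p.2 i))

/-- The level set `μ⁻¹ (α, β)` of the hyperkähler moment map. -/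
abbrev Level (K : Subgroup (RealTorus N)) (α : KDual K) (β : KDualC K) : Type :=
  {p : HN N // momentR K p = α ∧ momentC K p = β}

/-- Two points of `μ⁻¹ (α, β)` are equivalent if they lie in the same `K`-orbit. -/
def levelSetoid (K : Subgroup (RealTorus N)) (α : KDual K) (β : KDualC K) :
    Setoid (Level K α β) where
  r p q := ∃ g ∈ K, act (toComplexTorus g) p.1 = q.1
  iseqv :=
    { refl := fun p => ⟨1, K.one_mem, by rw [map_one, act_one]⟩
      symm := by
        rintro p q ⟨g, hg, h⟩
        exact ⟨g⁻¹, K.inv_mem hg, by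
          rw [← h, ← act_mul, ← map_mul, inv_mul_cancel, map_one, act_one]⟩
      trans := by
        rintro p q r ⟨g, hg, h⟩ ⟨g', hg', h'⟩
        exact ⟨g' * g, K.mul_mem hg' hg, by rw [map_mul, act_mul, h, h']⟩ }

/-- The toric hyperkähler variety `X(α, β) = μ⁻¹ (α, β) / K`, with the quotient topology. -/
abbrev X (K : Subgroup (RealTorus N)) (α : KDual K) (β : KDualC K) : Type :=
  Quotient (levelSetoid K α β)

/-- `α`-semi-stability of `(z, w)`, for an arbitrary real parameter `α ∈ k^*`:
`α ∈ ∑ ℝ_{≥0} |z_i|² ι^* u_i + ∑ ℝ_{≥0} |w_i|² (-ι^* u_i)`. -/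
def IsSemistable (K : Subgroup (RealTorus N)) (α : KDual K) (p : HN N) : Prop :=
  ∃ a b : Fin N → ℝ, (∀ i, 0 ≤ a i) ∧ (∀ i, 0 ≤ b i) ∧
    α = ∑ i, (a i * ‖p.1 i‖ ^ 2) • weight K i + ∑ i, (b i * ‖p.2 i‖ ^ 2) • (-weight K i)

theorem isSemistable_zero (K : Subgroup (RealTorus N)) (p : HN N) : IsSemistable K 0 p :=
  ⟨0, 0, fun _ => le_rfl, fun _ => le_rfl, by simp⟩

theorem isSemistable_momentR (K : Subgroup (RealTorus N)) (p : HN N) :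
    IsSemistable K (momentR K p) p := by
  refine ⟨fun _ => Real.pi, fun _ => Real.pi, fun _ => Real.pi_pos.le,
    fun _ => Real.pi_pos.le, ?_⟩
  rw [← Finset.sum_add_distrib]
  refine Finset.sum_congr rfl fun i _ => ?_
  ext x
  simp
  ring

/-- The set `μ_ℂ⁻¹ (β)^{α-ss}` of `α`-semi-stable points of `μ_ℂ⁻¹ (β)`. -/
abbrev Semistable (K : Subgroup (RealTorus N)) (α : KDual K) (β : KDualC K) : Type :=
  {p : HN N // momentC K p = β ∧ IsSemistable K α p}

/-- The `K_ℂ`-orbit of `p` in `μ_ℂ⁻¹ (β)^{α-ss}`. -/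
def orbit {K : Subgroup (RealTorus N)} {α : KDual K} {β : KDualC K} (p : Semistable K α β) :
    Set (Semistable K α β) :=
  {q | ∃ ζ ∈ complexification K, act ζ p.1 = q.1}

/-- Two `α`-semi-stable points are identified in the categorical quotient if the closures of
their `K_ℂ`-orbits in `μ_ℂ⁻¹ (β)^{α-ss}` meet. -/
def OrbitClosuresMeet {K : Subgroup (RealTorus N)} {α : KDual K} {β : KDualC K}
    (p q : Semistable K α β) : Prop :=
  (closure (orbit p) ∩ closure (orbit q)).Nonempty

/-- The categorical quotient `μ_ℂ⁻¹ (β)^{α-ss} // K_ℂ`, with the quotient topology. -/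
abbrev GIT (K : Subgroup (RealTorus N)) (α : KDual K) (β : KDualC K) : Type :=
  Quot (OrbitClosuresMeet (K := K) (α := α) (β := β))

/-- The function `f` on the subset `U` of `μ_ℂ⁻¹ (β)^{α-ss} // K_ℂ` is holomorphic: its pull-back
to `μ_ℂ⁻¹ (β)^{α-ss}` is locally the restriction of an `I₁`-holomorphic function on an open subset
of `ℍ^N`. -/
def IsHolomorphicOn {K : Subgroup (RealTorus N)} {α : KDual K} {β : KDualC K}
    (U : Set (GIT K α β)) (f : GIT K α β → ℂ) : Prop :=
  ∀ p : Semistable K α β, Quot.mk _ p ∈ U →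
    ∃ V : Set (HN N), IsOpen V ∧ p.1 ∈ V ∧ ∃ F : HN N → ℂ, DifferentiableOn ℂ F V ∧
      ∀ q : Semistable K α β, q.1 ∈ V → Quot.mk _ q ∈ U → f (Quot.mk _ q) = F q.1

/-- A map between categorical quotients is a morphism of complex spaces: it is continuous and
pulls back holomorphic functions on open sets to holomorphic functions. -/
def IsMorphism {K : Subgroup (RealTorus N)} {α α' : KDual K} {β β' : KDualC K}
    (φ : GIT K α β → GIT K α' β') : Prop :=
  Continuous φ ∧ ∀ (U : Set (GIT K α' β')) (f : GIT K α' β' → ℂ), IsOpen U →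
    IsHolomorphicOn U f → IsHolomorphicOn (φ ⁻¹' U) (f ∘ φ)

/-- The inclusion `μ⁻¹ (α, β) ⊆ μ_ℂ⁻¹ (β)^{α-ss}`. -/
def levelToSemistable {K : Subgroup (RealTorus N)} {α : KDual K} {β : KDualC K}
    (p : Level K α β) : Semistable K α β :=
  ⟨p.1, p.2.2, by have h := isSemistable_momentR K p.1; rwa [p.2.1] at h⟩

theorem mem_orbit_self {K : Subgroup (RealTorus N)} {α : KDual K} {β : KDualC K}
    (p : Semistable K α β) : p ∈ orbit p :=
  ⟨1, (complexification K).one_mem, act_one _⟩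

/-- The natural map `X(α, β) → μ_ℂ⁻¹ (β)^{α-ss} // K_ℂ` induced by the inclusion
`μ⁻¹ (α, β) ⊆ μ_ℂ⁻¹ (β)^{α-ss}`. -/
def toGIT (K : Subgroup (RealTorus N)) (α : KDual K) (β : KDualC K) : X K α β → GIT K α β :=
  Quotient.lift (fun p => Quot.mk _ (levelToSemistable p)) (by
    rintro p q ⟨g, hg, h⟩
    refine Quot.sound ⟨levelToSemistable q, subset_closure ?_, subset_closure (mem_orbit_self _)⟩
    exact ⟨toComplexTorus g, toComplexTorus_mem hg, h⟩)

/-- The inclusion `μ_ℂ⁻¹ (β)^{α-ss} ⊆ μ_ℂ⁻¹ (β) = μ_ℂ⁻¹ (β)^{0-ss}`. -/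
def semistableInclusion {K : Subgroup (RealTorus N)} {α : KDual K} {β : KDualC K}
    (p : Semistable K α β) : Semistable K 0 β :=
  ⟨p.1, p.2.1, isSemistable_zero K p.1⟩

theorem semistableInclusion_closure {K : Subgroup (RealTorus N)} {α : KDual K} {β : KDualC K}
    {p r : Semistable K α β} (h : r ∈ closure (orbit p)) :
    semistableInclusion r ∈ closure (orbit (semistableInclusion p)) := by
  have hc : Continuous (semistableInclusion (K := K) (α := α) (β := β)) :=
    Continuous.subtype_mk continuous_subtype_val _
  exact map_mem_closure hc h fun q hq => hq

/-- The natural morphism `μ_ℂ⁻¹ (β)^{α-ss} // K_ℂ → μ_ℂ⁻¹ (β) // K_ℂ` of quotients, induced by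
the inclusion `μ_ℂ⁻¹ (β)^{α-ss} ⊆ μ_ℂ⁻¹ (β)`. -/
def gitMap (K : Subgroup (RealTorus N)) (α : KDual K) (β : KDualC K) :
    GIT K α β → GIT K 0 β :=
  Quot.map semistableInclusion (by
    rintro p q ⟨r, hp, hq⟩
    exact ⟨semistableInclusion r, semistableInclusion_closure hp, semistableInclusion_closure hq⟩)

/-- `π : X(α, β) → X(0, β)` is the map corresponding to the natural morphism of quotients
`gitMap` under the natural maps from the hyperkähler quotients to the categorical quotients. -/
def IsNaturalMap (K : Subgroup (RealTorus N)) (α : KDual K) (β : KDualC K)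
    (π : X K α β → X K 0 β) : Prop :=
  ∀ x : X K α β, toGIT K 0 β (π x) = gitMap K α β (toGIT K α β x)

end ToricHyperkahler

/-!
Let `Γ` be the closure in `ℍ^N × ℍ^N` of the `K_ℂ`-orbit relation. The action of `Exp (√-1 Y)`
shrinks `|z_i|²` and stretches `|w_i|²` if `Y_i > 0`, and conversely if `Y_i < 0`, so it decreases
the pairing of `μ₁` with `Y` term by term, and can preserve it only by preserving all `|z_i|²` and
`|w_i|²`. As `K` is compact, `Γ`-related points with the same `μ₁` therefore lie in one `K`-orbit.
Applied to limits of rescaled pairs, this bounds the points of `μ₁⁻¹ (α)` that are `Γ`-related to a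
bounded set, so `Γ` is proper over `μ₁⁻¹ (α)`.

On the other hand, a minimising sequence of the Kempf–Ness function of an `α`-semi-stable point `p`
is Cauchy, by the parallelogram law, and its limit is a point of `μ₁⁻¹ (α)` in the closure of the
orbit of `p`. Hence two points have the same image in the quotient if and only if they are
`Γ`-related to a common point of `μ₁⁻¹ (α)`, and properness of the maps between quotients reduces to
that of `Γ`. For surjectivity, a point `t` of `μ₁⁻¹ (0)` is pushed off along a suitable `l ∈ k`
supported where `t` vanishes; the result is `α`-semi-stable, and flowing it along `Exp (√-1 s l)`
as `s → ∞` recovers `t`.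
-/

namespace ToricHyperkahler

open Filter Topology

variable {N : ℕ}

/-! ### The action and the moment maps -/

theorem act_imagExp_fst (Y : Fin N → ℝ) (p : HN N) (i : Fin N) :
    (act (imagExp Y) p).1 i = p.1 i * (Real.exp (-(2 * Real.pi * Y i)) : ℝ) := by
  simp only [act, imagExp, Units.val_mk0, Complex.ofReal_exp]
  congr 2
  push_cast
  linear_combination (2 * Real.pi * Y i : ℂ) * Complex.I_mul_I

theorem act_imagExp_snd (Y : Fin N → ℝ) (p : HN N) (i : Fin N) :
    (act (imagExp Y) p).2 i = p.2 i * (Real.exp (2 * Real.pi * Y i) : ℝ) := by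
  simp only [act, imagExp, Units.val_inv_eq_inv_val, Units.val_mk0, Complex.ofReal_exp,
    ← Complex.exp_neg]
  congr 2
  push_cast
  linear_combination (-2 * Real.pi * Y i : ℂ) * Complex.I_mul_I

theorem norm_act_imagExp_fst (Y : Fin N → ℝ) (p : HN N) (i : Fin N) :
    ‖(act (imagExp Y) p).1 i‖ = ‖p.1 i‖ * Real.exp (-(2 * Real.pi * Y i)) := by
  rw [act_imagExp_fst, norm_mul, Complex.norm_real, Real.norm_of_nonneg (Real.exp_pos _).le]

theorem norm_act_imagExp_snd (Y : Fin N → ℝ) (p : HN N) (i : Fin N) :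
    ‖(act (imagExp Y) p).2 i‖ = ‖p.2 i‖ * Real.exp (2 * Real.pi * Y i) := by
  rw [act_imagExp_snd, norm_mul, Complex.norm_real, Real.norm_of_nonneg (Real.exp_pos _).le]

theorem norm_act_toComplexTorus_fst (g : RealTorus N) (p : HN N) (i : Fin N) :
    ‖(act (toComplexTorus g) p).1 i‖ = ‖p.1 i‖ := by
  simp [act, toComplexTorus, Circle.norm_coe]

theorem norm_act_toComplexTorus_snd (g : RealTorus N) (p : HN N) (i : Fin N) :
    ‖(act (toComplexTorus g) p).2 i‖ = ‖p.2 i‖ := by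
  simp [act, toComplexTorus, Circle.norm_coe]

theorem norm_act_toComplexTorus (g : RealTorus N) (p : HN N) :
    ‖act (toComplexTorus g) p‖ = ‖p‖ := by
  simp only [Prod.norm_def, Pi.norm_def]
  congr 3 <;> ext i <;>
    simp [norm_act_toComplexTorus_fst, norm_act_toComplexTorus_snd]

theorem continuous_act (ζ : ComplexTorus N) : Continuous (act ζ) := by
  unfold act; fun_prop

theorem continuous_act_toComplexTorus :
    Continuous fun x : RealTorus N × HN N => act (toComplexTorus x.1) x.2 := by
  have h : (fun x : RealTorus N × HN N => act (toComplexTorus x.1) x.2) =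
      fun x : RealTorus N × HN N => (fun i => x.2.1 i * (x.1 i : ℂ),
        fun i => x.2.2 i * ((x.1 i)⁻¹ : Circle)) := by
    funext x
    simp [act, toComplexTorus]
  rw [h]
  fun_prop

theorem momentR_apply (K : Subgroup (RealTorus N)) (p : HN N) (Y : lieAlg K) :
    momentR K p Y = ∑ i, Real.pi * (‖p.1 i‖ ^ 2 - ‖p.2 i‖ ^ 2) * (Y : Fin N → ℝ) i := by
  simp [momentR, weight, LinearMap.sum_apply]

theorem momentR_act_toComplexTorus (K : Subgroup (RealTorus N)) (g : RealTorus N) (p : HN N) :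
    momentR K (act (toComplexTorus g) p) = momentR K p := by
  simp [momentR, norm_act_toComplexTorus_fst, norm_act_toComplexTorus_snd]

theorem continuous_momentR_apply (K : Subgroup (RealTorus N)) (Y : lieAlg K) :
    Continuous fun p => momentR K p Y := by
  simp only [momentR_apply]
  fun_prop

theorem isClosed_momentR_eq (K : Subgroup (RealTorus N)) (α : KDual K) :
    IsClosed {p | momentR K p = α} := by
  simp only [LinearMap.ext_iff, Set.ofPred_forall]
  exact isClosed_iInter fun Y => isClosed_eq (continuous_momentR_apply K Y) continuous_const

theorem momentC_eq_of_mul_eq (K : Subgroup (RealTorus N)) {p q : HN N}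
    (h : ∀ i, p.1 i * p.2 i = q.1 i * q.2 i) : momentC K p = momentC K q := by
  simp [momentC, h]

theorem momentC_act (K : Subgroup (RealTorus N)) (ζ : ComplexTorus N) (p : HN N) :
    momentC K (act ζ p) = momentC K p := by
  refine momentC_eq_of_mul_eq K fun i => ?_
  simp only [act, Units.val_inv_eq_inv_val]
  have := (ζ i).ne_zero
  field_simp

theorem continuous_momentC_apply (K : Subgroup (RealTorus N)) (Y : lieAlg K) :
    Continuous fun p => momentC K p Y := by
  simp only [momentC, LinearMap.sum_apply, LinearMap.smulRight_apply]
  fun_prop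

theorem isClosed_momentC_eq (K : Subgroup (RealTorus N)) (β : KDualC K) :
    IsClosed {p | momentC K p = β} := by
  simp only [LinearMap.ext_iff, Set.ofPred_forall]
  exact isClosed_iInter fun Y => isClosed_eq (continuous_momentC_apply K Y) continuous_const

theorem act_smul (ζ : ComplexTorus N) (c : ℝ) (p : HN N) : act ζ (c • p) = c • act ζ p := by
  ext i <;> simp [act, mul_assoc]

theorem act_imagExp_add (Y Z : Fin N → ℝ) (p : HN N) :
    act (imagExp (Y + Z)) p = act (imagExp Z) (act (imagExp Y) p) := by
  rw [add_comm, imagExp_add, act_mul]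

theorem imagExp_mem {K : Subgroup (RealTorus N)} (Y : lieAlg K) :
    imagExp (Y : Fin N → ℝ) ∈ complexification K :=
  ⟨1, K.one_mem, Y, Y.2, by rw [map_one, one_mul]⟩

theorem momentR_smul (K : Subgroup (RealTorus N)) (c : ℝ) (p : HN N) :
    momentR K (c • p) = c ^ 2 • momentR K p := by
  ext Y
  simp only [momentR_apply, LinearMap.smul_apply, smul_eq_mul, Finset.mul_sum, Prod.smul_fst,
    Prod.smul_snd, Pi.smul_apply, norm_smul, mul_pow, Real.norm_eq_abs, sq_abs]
  exact Finset.sum_congr rfl fun i _ => by ring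

/-! ### The closure of the orbit relation -/

/-- The `K_ℂ`-orbit of a point in the whole of `ℍ^N`. -/
def complexOrbit (K : Subgroup (RealTorus N)) (p : HN N) : Set (HN N) :=
  {q | ∃ ζ ∈ complexification K, act ζ p = q}

/-- The closure in `ℍ^N × ℍ^N` of the graph of the `K_ℂ`-orbit relation. Two points with the same
value of `μ₁` are related by it only if they lie in the same `K`-orbit. -/
def orbitGraphClosure (K : Subgroup (RealTorus N)) : SetRel (HN N) (HN N) :=
  closure {x | x.2 ∈ complexOrbit K x.1}

section OrbitGraphClosure

variable {K : Subgroup (RealTorus N)} {p q r t : HN N}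

theorem isClosed_orbitGraphClosure : IsClosed (orbitGraphClosure K : Set (HN N × HN N)) :=
  isClosed_closure

theorem act_mem_orbitGraphClosure {ζ : ComplexTorus N} (hζ : ζ ∈ complexification K) (p : HN N) :
    (p, act ζ p) ∈ orbitGraphClosure K :=
  subset_closure ⟨ζ, hζ, rfl⟩

theorem orbitGraphClosure_induction {P : HN N → HN N → Prop}
    (hP : IsClosed {x : HN N × HN N | P x.1 x.2})
    (hact : ∀ ζ ∈ complexification K, ∀ p, P p (act ζ p)) (h : (p, q) ∈ orbitGraphClosure K) :
    P p q := by
  refine closure_minimal ?_ hP h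
  rintro ⟨a, b⟩ ⟨ζ, hζ, hb⟩
  obtain rfl : act ζ a = b := hb
  exact hact ζ hζ a

theorem orbitGraphClosure_symm (h : (p, q) ∈ orbitGraphClosure K) :
    (q, p) ∈ orbitGraphClosure K := by
  refine orbitGraphClosure_induction (P := fun p q => (q, p) ∈ orbitGraphClosure K)
    (isClosed_orbitGraphClosure.preimage continuous_swap) (fun ζ hζ p => ?_) h
  simpa [← act_mul, act_one] using act_mem_orbitGraphClosure (inv_mem hζ) (act ζ p)

theorem orbitGraphClosure_smul (c : ℝ) (h : (p, q) ∈ orbitGraphClosure K) :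
    (c • p, c • q) ∈ orbitGraphClosure K := by
  refine orbitGraphClosure_induction (P := fun p q => (c • p, c • q) ∈ orbitGraphClosure K)
    (isClosed_orbitGraphClosure.preimage (continuous_const_smul c)) (fun ζ hζ p => ?_) h
  simpa only [act_smul] using act_mem_orbitGraphClosure hζ (c • p)

theorem orbitGraphClosure_act_left {ζ : ComplexTorus N} (hζ : ζ ∈ complexification K)
    (h : (p, q) ∈ orbitGraphClosure K) : (act ζ p, q) ∈ orbitGraphClosure K := by
  have hcont : Continuous fun x : HN N × HN N => (act ζ x.1, x.2) :=
    ((continuous_act ζ).comp continuous_fst).prodMk continuous_snd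
  refine orbitGraphClosure_induction (P := fun p q => (act ζ p, q) ∈ orbitGraphClosure K)
    (isClosed_orbitGraphClosure.preimage hcont) (fun ξ hξ p => ?_) h
  simpa [← act_mul] using act_mem_orbitGraphClosure (mul_mem hξ (inv_mem hζ)) (act ζ p)

theorem orbitGraphClosure_of_mem_closure (h : (p, q) ∈ orbitGraphClosure K)
    (hr : r ∈ closure (complexOrbit K p)) : (r, q) ∈ orbitGraphClosure K := by
  refine closure_minimal ?_
    (isClosed_orbitGraphClosure.preimage (by fun_prop : Continuous fun x : HN N => (x, q))) hr
  rintro _ ⟨ζ, hζ, rfl⟩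
  exact orbitGraphClosure_act_left hζ h

theorem mem_orbitGraphClosure_of_mem_closure (h : q ∈ closure (complexOrbit K p)) :
    (p, q) ∈ orbitGraphClosure K := by
  refine closure_minimal ?_
    (isClosed_orbitGraphClosure.preimage (by fun_prop : Continuous fun x : HN N => (p, x))) h
  rintro _ ⟨ζ, hζ, rfl⟩
  exact act_mem_orbitGraphClosure hζ p

theorem momentC_eq_of_mem_orbitGraphClosure (h : (p, q) ∈ orbitGraphClosure K) :
    momentC K p = momentC K q := by
  refine orbitGraphClosure_induction (P := fun p q => momentC K p = momentC K q) ?_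
    (fun ζ _ p => (momentC_act K ζ p).symm) h
  simp only [LinearMap.ext_iff, Set.ofPred_forall]
  exact isClosed_iInter fun Y => isClosed_eq ((continuous_momentC_apply K Y).comp continuous_fst)
    ((continuous_momentC_apply K Y).comp continuous_snd)

end OrbitGraphClosure

/-! ### Monotonicity of the moment map along imaginary directions -/

theorem eventually_nonneg_mul_of_tendsto_mul_exp {ι : Type*} {l : Filter ι} {x y c : ι → ℝ}
    {a b : ℝ} (hx : Tendsto x l (𝓝 a)) (hy : Tendsto y l (𝓝 b)) (hx0 : ∀ n, 0 ≤ x n)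
    (hxy : ∀ n, y n = x n * Real.exp (-c n)) :
    ∀ᶠ n in l, 0 ≤ (a - b) * c n ∧ ((a - b) * c n = 0 → a = b) := by
  rcases lt_trichotomy a b with hab | rfl | hab
  · filter_upwards [hx.eventually_lt hy hab] with n hlt
    have hc : c n < 0 := by
      by_contra! hc
      have := mul_le_of_le_one_right (hx0 n) (Real.exp_le_one_iff.2 (neg_nonpos.2 hc))
      exact absurd (hxy n) (by linarith)
    have := mul_pos_of_neg_of_neg (sub_neg.2 hab) hc
    exact ⟨this.le, fun h => absurd h this.ne'⟩
  · simp
  · filter_upwards [hy.eventually_lt hx hab] with n hlt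
    have hc : 0 < c n := by
      by_contra! hc
      have := le_mul_of_one_le_right (hx0 n) (Real.one_le_exp (neg_nonneg.2 hc))
      exact absurd (hxy n) (by linarith)
    have := mul_pos (sub_pos.2 hab) hc
    exact ⟨this.le, fun h => absurd h this.ne'⟩

theorem sameRay_of_tendsto {E ι : Type*} [NormedAddCommGroup E] [NormedSpace ℝ E] {l : Filter ι}
    [l.NeBot] {x y : ι → E} {a b : E} (hx : Tendsto x l (𝓝 a)) (hy : Tendsto y l (𝓝 b))
    (h : ∀ n, SameRay ℝ (x n) (y n)) : SameRay ℝ a b := by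
  rw [sameRay_iff_norm_smul_eq]
  refine tendsto_nhds_unique (hx.norm.smul hy) ?_
  simpa only [(h _).norm_smul_eq] using hy.norm.smul hx

/-- With `μ₁(t) = μ₁(q)`, pairing `μ₁(t) - μ₁(q)` with `Y n` gives a sum of terms
`(‖t_i‖² - ‖q_i‖²) Y_i` that are all eventually nonnegative, hence vanish. -/
theorem eq_of_tendsto_act_imagExp {K : Subgroup (RealTorus N)} {ι : Type*} {l : Filter ι} [l.NeBot]
    {p : ι → HN N} {Y : ι → lieAlg K} {t q : HN N} (hp : Tendsto p l (𝓝 t))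
    (hq : Tendsto (fun n => act (imagExp (Y n : Fin N → ℝ)) (p n)) l (𝓝 q))
    (h : momentR K t = momentR K q) : t = q := by
  have hp₁ := fun i => tendsto_pi_nhds.1 hp.fst_nhds i
  have hp₂ := fun i => tendsto_pi_nhds.1 hp.snd_nhds i
  have hq₁ := fun i => tendsto_pi_nhds.1 hq.fst_nhds i
  have hq₂ := fun i => tendsto_pi_nhds.1 hq.snd_nhds i
  have hmono₁ := fun i => eventually_nonneg_mul_of_tendsto_mul_exp ((hp₁ i).norm.pow 2)
    ((hq₁ i).norm.pow 2) (fun _ => sq_nonneg _) (c := fun n => 4 * Real.pi * (Y n : Fin N → ℝ) i)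
    fun n => by rw [norm_act_imagExp_fst, mul_pow, ← Real.exp_nat_mul]; ring_nf
  have hmono₂ := fun i => eventually_nonneg_mul_of_tendsto_mul_exp ((hp₂ i).norm.pow 2)
    ((hq₂ i).norm.pow 2) (fun _ => sq_nonneg _) (c := fun n => -(4 * Real.pi * (Y n : Fin N → ℝ) i))
    fun n => by rw [norm_act_imagExp_snd, mul_pow, ← Real.exp_nat_mul]; ring_nf
  obtain ⟨n, hn₁, hn₂⟩ := ((eventually_all.2 hmono₁).and (eventually_all.2 hmono₂)).exists
  have hsum : ∑ i, ((‖t.1 i‖ ^ 2 - ‖q.1 i‖ ^ 2) * (4 * Real.pi * (Y n : Fin N → ℝ) i) +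
      (‖t.2 i‖ ^ 2 - ‖q.2 i‖ ^ 2) * -(4 * Real.pi * (Y n : Fin N → ℝ) i)) = 0 := by
    calc _ = 4 * (momentR K t (Y n) - momentR K q (Y n)) := by
          rw [momentR_apply, momentR_apply, ← Finset.sum_sub_distrib, Finset.mul_sum]
          exact Finset.sum_congr rfl fun i _ => by ring
      _ = 0 := by rw [h, sub_self, mul_zero]
  have hzero := fun i => (add_eq_zero_iff_of_nonneg (hn₁ i).1 (hn₂ i).1).1
    ((Finset.sum_eq_zero_iff_of_nonneg fun i _ => add_nonneg (hn₁ i).1 (hn₂ i).1).1 hsum i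
      (Finset.mem_univ i))
  ext i
  · refine (sameRay_of_tendsto (hp₁ i) (hq₁ i) fun n => ?_).eq_of_norm_eq <|
      (sq_eq_sq₀ (norm_nonneg _) (norm_nonneg _)).1 ((hn₁ i).2 (hzero i).1)
    rw [act_imagExp_fst, mul_comm, ← Complex.real_smul]
    exact SameRay.sameRay_nonneg_smul_right _ (Real.exp_pos _).le
  · refine (sameRay_of_tendsto (hp₂ i) (hq₂ i) fun n => ?_).eq_of_norm_eq <|
      (sq_eq_sq₀ (norm_nonneg _) (norm_nonneg _)).1 ((hn₂ i).2 (hzero i).2)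
    rw [act_imagExp_snd, mul_comm, ← Complex.real_smul]
    exact SameRay.sameRay_nonneg_smul_right _ (Real.exp_pos _).le

theorem exists_act_eq_of_mem_orbitGraphClosure {K : Subgroup (RealTorus N)}
    (hK : IsClosed (K : Set (RealTorus N))) {t q : HN N} (htq : (t, q) ∈ orbitGraphClosure K)
    (h : momentR K t = momentR K q) : ∃ g ∈ K, act (toComplexTorus g) t = q := by
  obtain ⟨x, hx, hlim⟩ := mem_closure_iff_seq_limit.1 htq
  choose ζ hζ hact using hx
  choose g hg Y hY hζ using hζ
  obtain ⟨γ, hγ, φ, hφ, hgφ⟩ := hK.isCompact.tendsto_subseq hg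
  refine ⟨γ, hγ, ?_⟩
  have hlim := hlim.comp hφ.tendsto_atTop
  have himag : ∀ n,
      act (imagExp (Y n)) (x n).1 = act (toComplexTorus (g n)⁻¹) (x n).2 := fun n => by
    rw [← hact, hζ, act_mul, ← act_mul _ (toComplexTorus _), ← map_mul, inv_mul_cancel, map_one,
      act_one]
  have hlim' : Tendsto (fun n => act (imagExp (Y (φ n))) (x (φ n)).1) atTop
      (𝓝 (act (toComplexTorus γ⁻¹) q)) := by
    simp only [himag]
    exact (continuous_act_toComplexTorus.tendsto (γ⁻¹, q)).comp
      (hgφ.inv.prodMk_nhds hlim.snd_nhds)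
  have ht : t = _ := eq_of_tendsto_act_imagExp (Y := fun n => ⟨Y (φ n), hY (φ n)⟩)
    hlim.fst_nhds hlim' (by rw [momentR_act_toComplexTorus, h])
  rw [ht, ← act_mul, ← map_mul, mul_inv_cancel, map_one, act_one]

/-! ### Properness of the orbit relation on a level set of the real moment map -/

section

variable {K : Subgroup (RealTorus N)} {α : KDual K}

/-- Rescaling an unbounded family of counterexamples to the unit sphere would produce `q` with
`‖q‖ = 1`, `μ₁(q) = 0` and `(q, 0)` in the orbit graph closure. -/
theorem exists_norm_le_of_mem_orbitGraphClosure (hK : IsClosed (K : Set (RealTorus N)))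
    (α : KDual K) (C : ℝ) :
    ∃ R, ∀ p r, momentR K p = α → (p, r) ∈ orbitGraphClosure K → ‖r‖ ≤ C → ‖p‖ ≤ R := by
  by_contra! hunbdd
  choose p r hp hpr hr hlt using fun n : ℕ => hunbdd (n + 1)
  have hpos : ∀ n, 0 < ‖p n‖ := fun n => by linarith [hlt n, n.cast_nonneg (α := ℝ)]
  have hinv : Tendsto (fun n => ‖p n‖⁻¹) atTop (𝓝 0) :=
    tendsto_inv_atTop_zero.comp <| tendsto_atTop_mono (fun n => by linarith [hlt n])
      tendsto_natCast_atTop_atTop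
  obtain ⟨q, hq, φ, hφ, hlim⟩ := (isCompact_sphere (0 : HN N) 1).tendsto_subseq
    (x := fun n => ‖p n‖⁻¹ • p n) fun n => by
      simp [norm_smul, (hpos n).ne']
  have hinvφ := hinv.comp hφ.tendsto_atTop
  have hr0 : Tendsto (fun n => ‖p (φ n)‖⁻¹ • r (φ n)) atTop (𝓝 0) :=
    hinvφ.zero_smul_isBoundedUnder_le <| isBoundedUnder_of ⟨C, fun n => hr (φ n)⟩
  have hq0 : (q, 0) ∈ orbitGraphClosure K :=
    isClosed_orbitGraphClosure.mem_of_tendsto (hlim.prodMk_nhds hr0) <|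
      Eventually.of_forall fun n => orbitGraphClosure_smul _ (hpr (φ n))
  have hmoment : momentR K q = momentR K 0 := by
    ext Y
    refine (tendsto_nhds_unique (((continuous_momentR_apply K Y).tendsto q).comp hlim) ?_).trans
      (by simp [momentR_apply] : momentR K 0 Y = 0).symm
    simpa [Function.comp_def, momentR_smul, hp] using (hinvφ.pow 2).mul_const (α Y)
  obtain ⟨g, -, hg⟩ := exists_act_eq_of_mem_orbitGraphClosure hK hq0 hmoment
  have : ‖q‖ = 0 := by rw [← norm_act_toComplexTorus g, hg, norm_zero]
  simp [this] at hq

theorem isProperMap_snd_orbitGraphClosure (hK : IsClosed (K : Set (RealTorus N))) :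
    IsProperMap fun x : {x : HN N × HN N // x ∈ orbitGraphClosure K ∧ momentR K x.1 = α} =>
      x.1.2 := by
  refine isProperMap_iff_isCompact_preimage.2 ⟨by fun_prop, fun C hC => ?_⟩
  obtain ⟨B, hB⟩ := hC.isBounded.exists_norm_le
  obtain ⟨R, hR⟩ := exists_norm_le_of_mem_orbitGraphClosure hK α B
  have hclosed : IsClosed {x : HN N × HN N | x ∈ orbitGraphClosure K ∧ momentR K x.1 = α} :=
    isClosed_orbitGraphClosure.inter ((isClosed_momentR_eq K α).preimage continuous_fst)
  refine (hclosed.isClosedEmbedding_subtypeVal.isCompact_preimage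
    ((isCompact_closedBall (0 : HN N) R).prod hC)).of_isClosed_subset
      (hC.isClosed.preimage (by fun_prop)) fun x hx => ⟨?_, hx⟩
  exact mem_closedBall_zero_iff.2 (hR _ _ x.2.2 x.2.1 (hB _ hx))

theorem isClosed_image_orbitGraphClosure (hK : IsClosed (K : Set (RealTorus N))) {A : Set (HN N)}
    (hA : IsClosed A) (hAα : ∀ p ∈ A, momentR K p = α) :
    IsClosed ((orbitGraphClosure K).image A) := by
  convert (isProperMap_snd_orbitGraphClosure hK (α := α)).isClosedMap _
    (hA.preimage (by fun_prop : Continuous fun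
      x : {x : HN N × HN N // x ∈ orbitGraphClosure K ∧ momentR K x.1 = α} => x.1.1)) using 1
  ext r
  constructor
  · rintro ⟨p, hp, hpr⟩
    exact ⟨⟨(p, r), hpr, hAα p hp⟩, hp, rfl⟩
  · rintro ⟨x, hx, rfl⟩
    exact ⟨x.1.1, hx, x.2.1⟩

theorem isCompact_image_orbitGraphClosure_inter (hK : IsClosed (K : Set (RealTorus N)))
    {C : Set (HN N)} (hC : IsCompact C) :
    IsCompact ((orbitGraphClosure K).image C ∩ {r | momentR K r = α}) := by
  convert ((isProperMap_snd_orbitGraphClosure hK (α := α)).isCompact_preimage hC).image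
    (by fun_prop : Continuous fun
      x : {x : HN N × HN N // x ∈ orbitGraphClosure K ∧ momentR K x.1 = α} => x.1.1) using 1
  ext r
  constructor
  · rintro ⟨⟨p, hp, hpr⟩, hr⟩
    exact ⟨⟨(r, p), orbitGraphClosure_symm hpr, hr⟩, hp, rfl⟩
  · rintro ⟨x, hx, rfl⟩
    exact ⟨⟨x.1.2, hx, orbitGraphClosure_symm x.2.1⟩, x.2.2⟩

end

/-! ### The Kempf–Ness function -/

/-- The square of the Euclidean norm of `(z, w) ∈ ℂ^N × ℂ^N`; the norm of the product type `HN N`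
is the sup norm. -/
noncomputable def sqNorm (p : HN N) : ℝ := ∑ i, (‖p.1 i‖ ^ 2 + ‖p.2 i‖ ^ 2)

theorem continuous_sqNorm : Continuous (sqNorm (N := N)) := by
  unfold sqNorm; fun_prop

theorem norm_le_sqrt_sqNorm (p : HN N) : ‖p‖ ≤ √(sqNorm p) := by
  have hi : ∀ i, ‖p.1 i‖ ^ 2 + ‖p.2 i‖ ^ 2 ≤ sqNorm p := fun i =>
    Finset.single_le_sum (f := fun i => ‖p.1 i‖ ^ 2 + ‖p.2 i‖ ^ 2)
      (fun i _ => by positivity) (Finset.mem_univ i)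
  refine max_le ((pi_norm_le_iff_of_nonneg (Real.sqrt_nonneg _)).2 fun i => ?_)
    ((pi_norm_le_iff_of_nonneg (Real.sqrt_nonneg _)).2 fun i => ?_)
  · exact Real.le_sqrt_of_sq_le ((le_add_of_nonneg_right (sq_nonneg _)).trans (hi i))
  · exact Real.le_sqrt_of_sq_le ((le_add_of_nonneg_left (sq_nonneg _)).trans (hi i))

theorem sqNorm_act_imagExp (Y : Fin N → ℝ) (p : HN N) :
    sqNorm (act (imagExp Y) p) = ∑ i, (‖p.1 i‖ ^ 2 * Real.exp (-(4 * Real.pi * Y i)) +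
      ‖p.2 i‖ ^ 2 * Real.exp (4 * Real.pi * Y i)) := by
  refine Finset.sum_congr rfl fun i _ => ?_
  rw [norm_act_imagExp_fst, norm_act_imagExp_snd, mul_pow, mul_pow, ← Real.exp_nat_mul,
    ← Real.exp_nat_mul]
  congr 3 <;> push_cast <;> ring_nf

theorem norm_mul_exp_sub_mul_exp_sq (x : ℂ) (u v : ℝ) :
    ‖x * (Real.exp u : ℝ) - x * (Real.exp v : ℝ)‖ ^ 2 =
      ‖x * (Real.exp u : ℝ)‖ ^ 2 + ‖x * (Real.exp v : ℝ)‖ ^ 2 -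
        2 * ‖x * (Real.exp ((u + v) / 2) : ℝ)‖ ^ 2 := by
  have h : Real.exp ((u + v) / 2) ^ 2 = Real.exp u * Real.exp v := by
    rw [← Real.exp_nat_mul, ← Real.exp_add]; congr 1; push_cast; ring
  simp only [← mul_sub, ← Complex.ofReal_sub, norm_mul, Complex.norm_real, Real.norm_eq_abs,
    mul_pow, sq_abs, h]
  ring

theorem sqNorm_act_imagExp_sub (Y Z : Fin N → ℝ) (p : HN N) :
    sqNorm (act (imagExp Y) p - act (imagExp Z) p) = sqNorm (act (imagExp Y) p) +
      sqNorm (act (imagExp Z) p) - 2 * sqNorm (act (imagExp ((1 / 2 : ℝ) • (Y + Z))) p) := by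
  simp only [sqNorm, Finset.mul_sum, ← Finset.sum_add_distrib, ← Finset.sum_sub_distrib]
  refine Finset.sum_congr rfl fun i _ => ?_
  simp only [Prod.fst_sub, Prod.snd_sub, Pi.sub_apply, act_imagExp_fst, act_imagExp_snd,
    norm_mul_exp_sub_mul_exp_sq, Pi.smul_apply, Pi.add_apply, smul_eq_mul]
  ring_nf

section KempfNess

variable {K : Subgroup (RealTorus N)} {α : KDual K} {p q : HN N}

/-- The Kempf–Ness function of `p` for the parameter `α`, as a function on `k`. Its derivative at
`Y` is `α - μ₁(p · Exp (√-1 Y))`, so that its critical points correspond to points of `μ₁⁻¹ (α)` in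
the orbit of `p`. -/
noncomputable def kempfNess (α : KDual K) (p : HN N) (Y : lieAlg K) : ℝ :=
  sqNorm (act (imagExp (Y : Fin N → ℝ)) p) / 4 + α Y

theorem continuous_kempfNess (α : KDual K) (Y : lieAlg K) :
    Continuous fun p => kempfNess α p Y :=
  ((continuous_sqNorm.comp (continuous_act _)).div_const 4).add_const _

theorem kempfNess_add (α : KDual K) (p : HN N) (Y Z : lieAlg K) :
    kempfNess α p (Y + Z) = kempfNess α (act (imagExp (Y : Fin N → ℝ)) p) Z + α Y := by
  rw [kempfNess, kempfNess, Submodule.coe_add, act_imagExp_add, map_add]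
  ring

theorem sqNorm_act_imagExp_sub_eq_kempfNess (α : KDual K) (p : HN N) (Y Z : lieAlg K) :
    sqNorm (act (imagExp (Y : Fin N → ℝ)) p - act (imagExp (Z : Fin N → ℝ)) p) =
      4 * (kempfNess α p Y + kempfNess α p Z - 2 * kempfNess α p ((1 / 2 : ℝ) • (Y + Z))) := by
  simp only [sqNorm_act_imagExp_sub, kempfNess, map_smul, map_add, smul_eq_mul,
    Submodule.coe_smul, Submodule.coe_add]
  ring

theorem mul_one_sub_log_le_exp_neg_add_mul {a : ℝ} (ha : 0 ≤ a) (y : ℝ) :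
    a * (1 - Real.log a) ≤ Real.exp (-y) + a * y := by
  rcases ha.eq_or_lt with rfl | ha
  · simpa using (Real.exp_pos _).le
  · have h := Real.add_one_le_exp (-y - Real.log a)
    rw [Real.exp_sub, Real.exp_log ha, le_div_iff₀ ha] at h
    linarith

theorem bddBelow_kempfNess (h : IsSemistable K α p) :
    BddBelow (Set.range (kempfNess α p)) := by
  obtain ⟨a, b, ha, hb, rfl⟩ := h
  have hbound : ∀ {x : ℝ}, 0 ≤ x →
      ∃ C, ∀ y, C ≤ Real.exp (-(4 * Real.pi * y)) / 4 + x * y := fun {x} hx => by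
    refine ⟨x / Real.pi * (1 - Real.log (x / Real.pi)) / 4, fun y => ?_⟩
    have := mul_one_sub_log_le_exp_neg_add_mul (div_nonneg hx Real.pi_pos.le) (4 * Real.pi * y)
    rw [show x / Real.pi * (4 * Real.pi * y) = 4 * (x * y) by field_simp] at this
    linarith
  choose C hC using fun i => hbound (ha i)
  choose D hD using fun i => hbound (hb i)
  refine ⟨∑ i, (‖p.1 i‖ ^ 2 * C i + ‖p.2 i‖ ^ 2 * D i), ?_⟩
  rintro _ ⟨Y, rfl⟩
  simp only [kempfNess, sqNorm_act_imagExp, LinearMap.add_apply, LinearMap.sum_apply,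
    LinearMap.smul_apply, LinearMap.neg_apply, smul_eq_mul, Finset.sum_div,
    ← Finset.sum_add_distrib]
  refine Finset.sum_le_sum fun i _ => ?_
  have hz := mul_le_mul_of_nonneg_left (hC i ((Y : Fin N → ℝ) i)) (sq_nonneg ‖p.1 i‖)
  have hw := mul_le_mul_of_nonneg_left (hD i (-(Y : Fin N → ℝ) i)) (sq_nonneg ‖p.2 i‖)
  rw [mul_neg (4 * Real.pi), neg_neg] at hw
  rw [show weight K i Y = (Y : Fin N → ℝ) i from rfl]
  linarith

theorem hasDerivAt_kempfNess_smul (α : KDual K) (q : HN N) (Z : lieAlg K) :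
    HasDerivAt (fun s : ℝ => kempfNess α q (s • Z)) (α Z - momentR K q Z) 0 := by
  simp only [kempfNess, sqNorm_act_imagExp, map_smul, smul_eq_mul, Submodule.coe_smul,
    Pi.smul_apply, Finset.sum_div]
  rw [sub_eq_neg_add, momentR_apply, ← Finset.sum_neg_distrib]
  refine HasDerivAt.add (HasDerivAt.fun_sum fun i _ => ?_) (hasDerivAt_mul_const (α Z))
  have hlin := (hasDerivAt_mul_const (x := (0 : ℝ)) ((Z : Fin N → ℝ) i)).const_mul (4 * Real.pi)
  refine (((hlin.neg.exp.const_mul (‖q.1 i‖ ^ 2)).add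
    (hlin.exp.const_mul (‖q.2 i‖ ^ 2))).div_const 4).congr_deriv ?_
  simp only [Pi.neg_apply, zero_mul, mul_zero, neg_zero, Real.exp_zero]
  ring

theorem momentR_eq_of_forall_kempfNess_zero_le
    (h : ∀ Z, kempfNess α q 0 ≤ kempfNess α q Z) : momentR K q = α := by
  ext Z
  have hmin : IsLocalMin (fun s : ℝ => kempfNess α q (s • Z)) 0 :=
    Eventually.of_forall fun s => by simpa using h (s • Z)
  linarith [hmin.hasDerivAt_eq_zero (hasDerivAt_kempfNess_smul α q Z)]

theorem cauchySeq_act_imagExp_of_tendsto_kempfNess {Y : ℕ → lieAlg K} {m : ℝ}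
    (hm : ∀ Z, m ≤ kempfNess α p Z)
    (hY : Tendsto (fun n => kempfNess α p (Y n)) atTop (𝓝 m)) :
    CauchySeq fun n => act (imagExp (Y n : Fin N → ℝ)) p := by
  have hlim : Tendsto (fun n : ℕ × ℕ =>
      √(4 * (kempfNess α p (Y n.1) + kempfNess α p (Y n.2) - 2 * m))) atTop (𝓝 0) := by
    rw [← prod_atTop_atTop_eq]
    simpa [← two_mul] using ((((hY.comp tendsto_fst).add (hY.comp tendsto_snd)).sub_const
      (2 * m)).const_mul 4).sqrt
  refine cauchySeq_iff_tendsto_dist_atTop_0.2 <|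
    squeeze_zero (fun _ => dist_nonneg) (fun n => ?_) hlim
  rw [dist_eq_norm]
  refine (norm_le_sqrt_sqNorm _).trans (Real.sqrt_le_sqrt ?_)
  rw [sqNorm_act_imagExp_sub_eq_kempfNess α]
  linarith [hm ((1 / 2 : ℝ) • (Y n.1 + Y n.2))]

theorem momentR_eq_of_tendsto_kempfNess {Y : ℕ → lieAlg K} {m : ℝ}
    (hm : ∀ Z, m ≤ kempfNess α p Z) (hY : Tendsto (fun n => kempfNess α p (Y n)) atTop (𝓝 m))
    (hq : Tendsto (fun n => act (imagExp (Y n : Fin N → ℝ)) p) atTop (𝓝 q)) :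
    momentR K q = α := by
  refine momentR_eq_of_forall_kempfNess_zero_le fun Z => sub_nonneg.1 ?_
  have hlim := (((continuous_kempfNess α Z).tendsto q).comp hq).sub
    (((continuous_kempfNess α 0).tendsto q).comp hq)
  refine le_of_tendsto_of_tendsto' (by simpa using hY.const_sub m) hlim fun n => ?_
  have hYZ := hm (Y n + Z)
  have hY0 := kempfNess_add α p (Y n) 0
  rw [kempfNess_add] at hYZ
  rw [add_zero] at hY0
  simp only [Function.comp_apply]
  linarith

theorem exists_momentR_eq_mem_closure_complexOrbit (h : IsSemistable K α p) :
    ∃ q ∈ closure (complexOrbit K p), momentR K q = α := by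
  have hbdd := bddBelow_kempfNess h
  have hm : ∀ Z, sInf (Set.range (kempfNess α p)) ≤ kempfNess α p Z := fun Z =>
    csInf_le hbdd ⟨Z, rfl⟩
  obtain ⟨_, -, hlim, hrange⟩ := exists_seq_tendsto_sInf (Set.range_nonempty _) hbdd
  choose Y hY using hrange
  obtain rfl : (fun n => kempfNess α p (Y n)) = _ := funext hY
  obtain ⟨q, hq⟩ := cauchySeq_tendsto_of_complete
    (cauchySeq_act_imagExp_of_tendsto_kempfNess hm hlim)
  exact ⟨q, mem_closure_of_tendsto hq (Eventually.of_forall fun n => ⟨_, imagExp_mem (Y n), rfl⟩),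
    momentR_eq_of_tendsto_kempfNess hm hlim hq⟩

end KempfNess

/-! ### Semistable points degenerating to the zero level -/

theorem exists_mem_forall_eq_dotProduct_add {𝕜 ι : Type*} [Field 𝕜] [LinearOrder 𝕜]
    [IsStrictOrderedRing 𝕜] [Fintype ι] (W : Submodule 𝕜 (ι → 𝕜)) (f : Module.Dual 𝕜 W)
    (S : Set ι) :
    ∃ l ∈ W, ∃ d : ι → 𝕜, (∀ i ∈ S, l i = 0) ∧ (∀ i ∉ S, d i = 0) ∧
      ∀ y : W, f y = (l + d) ⬝ᵥ y := by
  classical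
  let A : Submodule 𝕜 (ι → 𝕜) := W ⊓ Submodule.pi S (fun _ => ⊥) ⊔ Submodule.pi Sᶜ (fun _ => ⊥)
  let Φ : Submodule 𝕜 (Module.Dual 𝕜 W) :=
    A.map (W.dualRestrict ∘ₗ (dotProductEquiv 𝕜 ι).toLinearMap)
  have hcoann : Φ.dualCoannihilator = ⊥ := by
    refine (Submodule.eq_bot_iff _).2 fun y hy => ?_
    have horth : ∀ c ∈ A, c ⬝ᵥ (y : ι → 𝕜) = 0 := fun c hc =>
      (Submodule.mem_dualCoannihilator y).1 hy _ (Submodule.mem_map_of_mem hc)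
    have hyS : ∀ i ∈ S, (y : ι → 𝕜) i = 0 := fun i hi => by
      have hsingle : Pi.single i 1 ∈ A := Submodule.mem_sup_right fun j hj =>
        Pi.single_eq_of_ne (fun h : j = i => hj (h ▸ hi)) 1
      simpa using horth _ hsingle
    exact Subtype.ext <| dotProduct_self_eq_zero.1 <|
      horth _ (Submodule.mem_sup_left ⟨y.2, fun i hi => hyS i hi⟩)
  have htop : Φ = ⊤ := by
    rw [← Subspace.dualCoannihilator_dualAnnihilator_eq (W := Φ), hcoann,
      Submodule.dualAnnihilator_bot]
  obtain ⟨_, hc, rfl⟩ : f ∈ Φ := htop ▸ Submodule.mem_top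
  obtain ⟨l, hl, d, hd, rfl⟩ := Submodule.mem_sup.1 hc
  exact ⟨l, hl.1, d, hl.2, hd, fun y => rfl⟩

theorem isSemistable_of_eq_sum {K : Subgroup (RealTorus N)} {α : KDual K} {q : HN N}
    {c : Fin N → ℝ} (hα : α = ∑ i, c i • weight K i) (hpos : ∀ i, 0 < c i → q.1 i ≠ 0)
    (hneg : ∀ i, c i < 0 → q.2 i ≠ 0) : IsSemistable K α q := by
  refine ⟨fun i => (c i)⁺ / ‖q.1 i‖ ^ 2, fun i => (c i)⁻ / ‖q.2 i‖ ^ 2,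
    fun i => div_nonneg (posPart_nonneg _) (sq_nonneg _),
    fun i => div_nonneg (negPart_nonneg _) (sq_nonneg _), ?_⟩
  rw [hα, ← Finset.sum_add_distrib]
  refine Finset.sum_congr rfl fun i _ => ?_
  have hz : (c i)⁺ / ‖q.1 i‖ ^ 2 * ‖q.1 i‖ ^ 2 = (c i)⁺ := div_mul_cancel_of_imp fun h => by
    simpa using mt (hpos i) (not_not.2 (by simpa using h))
  have hw : (c i)⁻ / ‖q.2 i‖ ^ 2 * ‖q.2 i‖ ^ 2 = (c i)⁻ := div_mul_cancel_of_imp fun h => by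
    simpa using mt (hneg i) (not_not.2 (by simpa using h))
  rw [hz, hw, smul_neg, ← neg_smul, ← add_smul, ← sub_eq_add_neg, posPart_sub_negPart]

/-- The translate of `t` by the positive part of `l` in the `z`-coordinates and by its negative part
in the `w`-coordinates. If `l` is supported where `t` vanishes, then `perturb t l` flows to `t`
under `Exp (√-1 s l)` as `s → ∞`. -/
def perturb (t : HN N) (l : Fin N → ℝ) : HN N :=
  (fun i => t.1 i + ((l i)⁺ : ℝ), fun i => t.2 i + ((l i)⁻ : ℝ))

theorem tendsto_add_posPart_mul_exp {a : ℂ} {l : ℝ} (h : a ≠ 0 → l = 0) :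
    Tendsto (fun s : ℝ => (a + (l⁺ : ℝ)) * (Real.exp (-(2 * Real.pi * (s * l))) : ℝ)) atTop
      (𝓝 a) := by
  rcases le_or_gt l 0 with hl | hl
  · rcases eq_or_ne a 0 with rfl | ha
    · simp [posPart_eq_zero.2 hl]
    · simp [h ha]
  · obtain rfl : a = 0 := by_contra fun ha => hl.ne' (h ha)
    have hexp := Real.tendsto_exp_neg_atTop_nhds_zero.comp <|
      (tendsto_id.atTop_mul_const hl).const_mul_atTop Real.two_pi_pos
    simpa using ((Complex.continuous_ofReal.tendsto 0).comp hexp).const_mul (0 + ((l⁺ : ℝ) : ℂ))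

theorem eventually_add_posPart_ne_zero {z w : ℂ} {l d : ℝ} (hl : z ≠ 0 ∨ w ≠ 0 → l = 0)
    (hd : ¬(z ≠ 0 ∨ w ≠ 0) → d = 0) :
    ∀ᶠ M : ℝ in atTop, 0 < l + d + M * (‖z‖ ^ 2 - ‖w‖ ^ 2) → z + (l⁺ : ℝ) ≠ 0 := by
  rcases ne_or_eq z 0 with hz | rfl
  · simp [hl (Or.inl hz), hz]
  rcases ne_or_eq w 0 with hw | rfl
  · have hneg : ‖(0 : ℂ)‖ ^ 2 - ‖w‖ ^ 2 < 0 := by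
      simpa using pow_pos (norm_pos_iff.2 hw) 2
    filter_upwards [(tendsto_atBot_add_const_left atTop (l + d)
      (tendsto_id.atTop_mul_const_of_neg hneg)).eventually_le_atBot 0] with M hM hpos
    exact absurd hpos hM.not_gt
  · simp +contextual [hd, posPart_eq_zero]

section Perturb

variable {K : Subgroup (RealTorus N)} {t : HN N}

theorem momentC_perturb {l : Fin N → ℝ} (hl : ∀ i, t.1 i ≠ 0 ∨ t.2 i ≠ 0 → l i = 0) :
    momentC K (perturb t l) = momentC K t := by
  refine momentC_eq_of_mul_eq K fun i => ?_
  by_cases h : t.1 i ≠ 0 ∨ t.2 i ≠ 0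
  · simp [perturb, hl i h]
  · obtain ⟨hz, hw⟩ := not_or.1 h
    simpa [perturb, not_not.1 hz, not_not.1 hw] using le_total (l i) 0

theorem mem_closure_complexOrbit_perturb {l : lieAlg K}
    (hl : ∀ i, t.1 i ≠ 0 ∨ t.2 i ≠ 0 → (l : Fin N → ℝ) i = 0) :
    t ∈ closure (complexOrbit K (perturb t l)) := by
  refine mem_closure_of_tendsto (b := atTop)
    (f := fun s : ℝ => act (imagExp ((s • l : lieAlg K) : Fin N → ℝ)) (perturb t l))
    (Tendsto.prodMk_nhds (tendsto_pi_nhds.2 fun i => ?_) (tendsto_pi_nhds.2 fun i => ?_))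
    (Eventually.of_forall fun s => ⟨_, imagExp_mem _, rfl⟩)
  · refine (tendsto_add_posPart_mul_exp fun h => hl i (Or.inl h)).congr fun s => ?_
    exact (act_imagExp_fst (s • (l : Fin N → ℝ)) (perturb t l) i).symm
  · refine (tendsto_add_posPart_mul_exp (l := -(l : Fin N → ℝ) i) fun h => by
      rw [hl i (Or.inr h), neg_zero]).congr fun s => ?_
    rw [posPart_neg, mul_neg, mul_neg, neg_neg]
    exact (act_imagExp_snd (s • (l : Fin N → ℝ)) (perturb t l) i).symm

theorem exists_isSemistable_perturb (α : KDual K) (ht : momentR K t = 0) :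
    ∃ l : lieAlg K, (∀ i, t.1 i ≠ 0 ∨ t.2 i ≠ 0 → (l : Fin N → ℝ) i = 0) ∧
      IsSemistable K α (perturb t l) := by
  obtain ⟨l, hlK, d, hl, hd, hα⟩ :=
    exists_mem_forall_eq_dotProduct_add (lieAlg K) α {i | t.1 i ≠ 0 ∨ t.2 i ≠ 0}
  have hz := eventually_all.2 fun i => eventually_add_posPart_ne_zero (hl i) (hd i)
  have hw := eventually_all.2 fun i => eventually_add_posPart_ne_zero (z := t.2 i) (w := t.1 i)
    (l := -l i) (d := -d i) (fun h => by rw [hl i h.symm, neg_zero])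
    (fun h => by rw [hd i (mt Or.symm h), neg_zero])
  obtain ⟨M, hMz, hMw⟩ := (hz.and hw).exists
  refine ⟨⟨l, hlK⟩, hl, isSemistable_of_eq_sum
    (c := fun i => l i + d i + M * (‖t.1 i‖ ^ 2 - ‖t.2 i‖ ^ 2)) ?_ hMz fun i hi => ?_⟩
  · ext Y
    calc α Y = (l + d) ⬝ᵥ (Y : Fin N → ℝ) + M / Real.pi * momentR K t Y := by
          rw [hα, ht, LinearMap.zero_apply, mul_zero, add_zero]
      _ = ∑ i, (l i + d i + M * (‖t.1 i‖ ^ 2 - ‖t.2 i‖ ^ 2)) * (Y : Fin N → ℝ) i := by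
          rw [momentR_apply, dotProduct, Finset.mul_sum, ← Finset.sum_add_distrib]
          refine Finset.sum_congr rfl fun i _ => ?_
          rw [Pi.add_apply]
          field_simp
      _ = _ := by simp [LinearMap.sum_apply, weight]
  · simpa [perturb] using hMw i (by linarith)

theorem exists_isSemistable_mem_closure (α : KDual K) (ht : momentR K t = 0) :
    ∃ q, IsSemistable K α q ∧ momentC K q = momentC K t ∧ t ∈ closure (complexOrbit K q) :=
  let ⟨l, hl, hss⟩ := exists_isSemistable_perturb α ht
  ⟨perturb t l, hss, momentC_perturb hl, mem_closure_complexOrbit_perturb hl⟩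

end Perturb

/-! ### The quotient by the closure of orbits -/

section GIT

variable {K : Subgroup (RealTorus N)} {α : KDual K} {β : KDualC K}

theorem isSemistable_act {p : HN N} (h : IsSemistable K α p) (ζ : ComplexTorus N) :
    IsSemistable K α (act ζ p) := by
  obtain ⟨a, b, ha, hb, rfl⟩ := h
  have hζ : ∀ i, ‖(ζ i : ℂ)‖ ≠ 0 := fun i => norm_ne_zero_iff.2 (ζ i).ne_zero
  refine ⟨fun i => a i / ‖(ζ i : ℂ)‖ ^ 2, fun i => b i * ‖(ζ i : ℂ)‖ ^ 2,
    fun i => div_nonneg (ha i) (sq_nonneg _), fun i => mul_nonneg (hb i) (sq_nonneg _), ?_⟩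
  simp only [act, norm_mul, Units.val_inv_eq_inv_val, norm_inv]
  congr 1 <;> refine Finset.sum_congr rfl fun i _ => ?_ <;> congr 1 <;> field_simp [hζ i]

theorem mem_closure_orbit_iff {p r : Semistable K α β} :
    r ∈ closure (orbit p) ↔ r.1 ∈ closure (complexOrbit K p.1) := by
  rw [closure_subtype]
  congr! 2
  ext x
  constructor
  · rintro ⟨q, hq, rfl⟩
    exact hq
  · rintro ⟨ζ, hζ, rfl⟩
    exact ⟨⟨act ζ p.1, by rw [momentC_act, p.2.1], isSemistable_act p.2.2 ζ⟩, ⟨ζ, hζ, rfl⟩, rfl⟩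

theorem git_mk_eq_of_mem_closure {p r : Semistable K α β} (h : r ∈ closure (orbit p)) :
    (Quot.mk _ r : GIT K α β) = Quot.mk _ p :=
  Quot.sound ⟨r, subset_closure (mem_orbit_self r), h⟩

theorem act_mem_closure_complexOrbit {ζ : ComplexTorus N} (hζ : ζ ∈ complexification K)
    {p q : HN N} (h : q ∈ closure (complexOrbit K p)) :
    act ζ q ∈ closure (complexOrbit K p) := by
  refine map_mem_closure (continuous_act ζ) h ?_
  rintro _ ⟨ξ, hξ, rfl⟩
  exact ⟨ζ * ξ, mul_mem hζ hξ, act_mul ζ ξ p⟩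

theorem mem_closure_complexOrbit_of_momentR_eq (hK : IsClosed (K : Set (RealTorus N)))
    {p r : HN N} (hp : IsSemistable K α p) (hpr : (p, r) ∈ orbitGraphClosure K)
    (hr : momentR K r = α) : r ∈ closure (complexOrbit K p) := by
  obtain ⟨s, hs, hsα⟩ := exists_momentR_eq_mem_closure_complexOrbit hp
  obtain ⟨g, hg, rfl⟩ := exists_act_eq_of_mem_orbitGraphClosure hK
    (orbitGraphClosure_of_mem_closure hpr hs) (hsα.trans hr.symm)
  exact act_mem_closure_complexOrbit (toComplexTorus_mem hg) hs

theorem mem_orbitGraphClosure_of_momentR_eq (hK : IsClosed (K : Set (RealTorus N)))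
    {p q r s : HN N} (hq : IsSemistable K α q) (hpr : (p, r) ∈ orbitGraphClosure K)
    (hqr : (q, r) ∈ orbitGraphClosure K) (hqs : (q, s) ∈ orbitGraphClosure K)
    (hr : momentR K r = α) (hs : momentR K s = α) : (p, s) ∈ orbitGraphClosure K := by
  have hrs := orbitGraphClosure_of_mem_closure hqs
    (mem_closure_complexOrbit_of_momentR_eq hK hq hqr hr)
  obtain ⟨g, hg, rfl⟩ := exists_act_eq_of_mem_orbitGraphClosure hK hrs (hr.trans hs.symm)
  exact orbitGraphClosure_symm <| orbitGraphClosure_act_left (toComplexTorus_mem hg) <|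
    orbitGraphClosure_symm hpr

theorem git_mk_eq_mk_iff (hK : IsClosed (K : Set (RealTorus N))) {p q : Semistable K α β} :
    (Quot.mk _ p : GIT K α β) = Quot.mk _ q ↔
      ∃ r, momentR K r = α ∧ (p.1, r) ∈ orbitGraphClosure K ∧ (q.1, r) ∈ orbitGraphClosure K := by
  constructor
  · rw [Quot.eq]
    intro h
    induction h with
    | rel p q h =>
      obtain ⟨s, hps, hqs⟩ := h
      obtain ⟨r, hr, hrα⟩ := exists_momentR_eq_mem_closure_complexOrbit s.2.2
      have hclosure : ∀ {x : Semistable K α β}, s ∈ closure (orbit x) →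
          (x.1, r) ∈ orbitGraphClosure K := fun hx =>
        orbitGraphClosure_symm <| orbitGraphClosure_of_mem_closure (orbitGraphClosure_symm <|
          mem_orbitGraphClosure_of_mem_closure (mem_closure_orbit_iff.1 hx)) hr
      exact ⟨r, hrα, hclosure hps, hclosure hqs⟩
    | refl p =>
      obtain ⟨r, hr, hrα⟩ := exists_momentR_eq_mem_closure_complexOrbit p.2.2
      have hpr := mem_orbitGraphClosure_of_mem_closure hr
      exact ⟨r, hrα, hpr, hpr⟩
    | symm p q _ ih =>
      obtain ⟨r, hr, hpr, hqr⟩ := ih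
      exact ⟨r, hr, hqr, hpr⟩
    | trans p q x _ _ ihpq ihqx =>
      obtain ⟨r, hr, hpr, hqr⟩ := ihpq
      obtain ⟨s, hs, hqs, hxs⟩ := ihqx
      exact ⟨s, hs, mem_orbitGraphClosure_of_momentR_eq hK q.2.2 hpr hqr hqs hr hs, hxs⟩
  · rintro ⟨r, hr, hpr, hqr⟩
    let r' : Semistable K α β := levelToSemistable
      ⟨r, hr, (momentC_eq_of_mem_orbitGraphClosure hpr).symm.trans p.2.1⟩
    exact Quot.sound ⟨r',
      mem_closure_orbit_iff.2 (mem_closure_complexOrbit_of_momentR_eq hK p.2.2 hpr hr),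
      mem_closure_orbit_iff.2 (mem_closure_complexOrbit_of_momentR_eq hK q.2.2 hqr hr)⟩

theorem continuous_levelToSemistable :
    Continuous (levelToSemistable (K := K) (α := α) (β := β)) :=
  continuous_subtype_val.subtype_mk _

theorem continuous_semistableInclusion :
    Continuous (semistableInclusion (K := K) (α := α) (β := β)) :=
  continuous_subtype_val.subtype_mk _

theorem continuous_toGIT : Continuous (toGIT K α β) :=
  (continuous_quot_mk.comp continuous_levelToSemistable).quotient_lift _

theorem continuous_gitMap : Continuous (gitMap K α β) :=
  continuous_quot_lift _ (continuous_quot_mk.comp continuous_semistableInclusion)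

theorem isMorphism_gitMap : IsMorphism (gitMap K α β) :=
  ⟨continuous_gitMap, fun U f _ hf p hp => by
    obtain ⟨V, hV, hpV, F, hF, h⟩ := hf (semistableInclusion p) hp
    exact ⟨V, hV, hpV, F, hF, fun q => h (semistableInclusion q)⟩⟩

theorem surjective_toGIT : Function.Surjective (toGIT K α β) := by
  rintro ⟨p⟩
  obtain ⟨r, hr, hrα⟩ := exists_momentR_eq_mem_closure_complexOrbit p.2.2
  have hrβ := momentC_eq_of_mem_orbitGraphClosure (mem_orbitGraphClosure_of_mem_closure hr)
  exact ⟨Quotient.mk _ ⟨r, hrα, hrβ.symm.trans p.2.1⟩,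
    git_mk_eq_of_mem_closure (mem_closure_orbit_iff.2 hr)⟩

theorem injective_toGIT (hK : IsClosed (K : Set (RealTorus N))) :
    Function.Injective (toGIT K α β) := by
  rintro ⟨p⟩ ⟨q⟩ h
  obtain ⟨r, hr, hpr, hqr⟩ := (git_mk_eq_mk_iff hK).1 h
  obtain ⟨g, hg, rfl⟩ := exists_act_eq_of_mem_orbitGraphClosure hK hpr (p.2.1.trans hr.symm)
  obtain ⟨g', hg', hgq⟩ := exists_act_eq_of_mem_orbitGraphClosure hK
    (orbitGraphClosure_symm hqr) (hr.trans q.2.1.symm)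
  exact Quotient.sound ⟨g' * g, K.mul_mem hg' hg, by rw [map_mul, act_mul]; exact hgq⟩

theorem surjective_gitMap : Function.Surjective (gitMap K α β) := by
  intro y
  obtain ⟨⟨t⟩, rfl⟩ := surjective_toGIT y
  obtain ⟨q, hq, hqβ, hcl⟩ := exists_isSemistable_mem_closure α t.2.1
  exact ⟨Quot.mk _ ⟨q, hqβ.trans t.2.2, hq⟩,
    (git_mk_eq_of_mem_closure (mem_closure_orbit_iff.2 hcl)).symm⟩

/-! ### Properness -/

theorem isClosedEmbedding_level_val :
    IsClosedEmbedding (Subtype.val : Level K α β → HN N) :=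
  ((isClosed_momentR_eq K α).inter (isClosed_momentC_eq K β)).isClosedEmbedding_subtypeVal

theorem isClosedMap_level_gitMap (hK : IsClosed (K : Set (RealTorus N))) :
    IsClosedMap fun p : Level K α β => gitMap K α β (toGIT K α β (Quotient.mk _ p)) := by
  intro F hF
  have hF' : IsClosed (Subtype.val '' F) := isClosedEmbedding_level_val.isClosedMap F hF
  have hzero := (isClosed_image_orbitGraphClosure hK hF' (by
    rintro _ ⟨p, -, rfl⟩; exact p.2.1)).inter (isClosed_momentR_eq K 0)
  have hsat := isClosed_image_orbitGraphClosure hK hzero fun r hr => hr.2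
  rw [← isQuotientMap_quot_mk.isClosed_preimage]
  convert hsat.preimage (continuous_subtype_val : Continuous (Subtype.val : Semistable K 0 β → _))
  ext y
  constructor
  · rintro ⟨p, hp, hpy⟩
    obtain ⟨r, hr, hpr, hyr⟩ := (git_mk_eq_mk_iff hK).1 hpy
    exact ⟨r, ⟨⟨p, ⟨p, hp, rfl⟩, hpr⟩, hr⟩, orbitGraphClosure_symm hyr⟩
  · rintro ⟨r, ⟨⟨_, ⟨p, hp, rfl⟩, hpr⟩, hr⟩, hry⟩
    exact ⟨p, hp, (git_mk_eq_mk_iff hK).2 ⟨r, hr, hpr, orbitGraphClosure_symm hry⟩⟩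

theorem isCompact_level_gitMap_fiber (hK : IsClosed (K : Set (RealTorus N))) (y : GIT K 0 β) :
    IsCompact ((fun p : Level K α β => gitMap K α β (toGIT K α β (Quotient.mk _ p))) ⁻¹' {y}) := by
  obtain ⟨y, rfl⟩ := Quot.mk_surjective y
  have hcompact := isCompact_image_orbitGraphClosure_inter (α := α) hK
    (isCompact_image_orbitGraphClosure_inter (α := 0) hK (isCompact_singleton (x := y.1)))
  convert isClosedEmbedding_level_val.isCompact_preimage hcompact
  ext p
  refine (git_mk_eq_mk_iff hK).trans ⟨?_, ?_⟩
  · rintro ⟨r, hr, hpr, hyr⟩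
    exact ⟨⟨r, ⟨⟨y, rfl, hyr⟩, hr⟩, orbitGraphClosure_symm hpr⟩, p.2.1⟩
  · rintro ⟨⟨r, ⟨⟨_, rfl, hyr⟩, hr⟩, hrp⟩, -⟩
    exact ⟨r, hr, orbitGraphClosure_symm hrp, hyr⟩

theorem isProperMap_gitMap_comp_toGIT (hK : IsClosed (K : Set (RealTorus N))) :
    IsProperMap (gitMap K α β ∘ toGIT K α β) :=
  isProperMap_of_comp_of_surj continuous_quotient_mk' (continuous_gitMap.comp continuous_toGIT)
    (isProperMap_iff_isClosedMap_and_compact_fibers.2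
      ⟨(continuous_gitMap.comp continuous_toGIT).comp continuous_quotient_mk',
        isClosedMap_level_gitMap hK, isCompact_level_gitMap_fiber hK⟩)
    Quotient.mk_surjective

theorem isProperMap_gitMap (hK : IsClosed (K : Set (RealTorus N))) :
    IsProperMap (gitMap K α β) :=
  isProperMap_of_comp_of_surj continuous_toGIT continuous_gitMap
    (isProperMap_gitMap_comp_toGIT hK) surjective_toGIT

theorem gitMap_zero : gitMap K 0 β = id :=
  funext (Quot.ind fun _ => rfl)

theorem isHomeomorph_toGIT_zero (hK : IsClosed (K : Set (RealTorus N))) :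
    IsHomeomorph (toGIT K 0 β) := by
  have hproper : IsProperMap (toGIT K 0 β) := by
    simpa only [gitMap_zero, Function.id_comp] using
      isProperMap_gitMap_comp_toGIT (α := 0) (β := β) hK
  exact isHomeomorph_iff_continuous_isClosedMap_bijective.2
    ⟨hproper.continuous, hproper.isClosedMap, injective_toGIT hK, surjective_toGIT⟩

theorem isNaturalMap_iff (hK : IsClosed (K : Set (RealTorus N))) {π : X K α β → X K 0 β} :
    IsNaturalMap K α β π ↔
      π = (isHomeomorph_toGIT_zero hK).homeomorph.symm ∘ gitMap K α β ∘ toGIT K α β := by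
  rw [funext_iff]
  exact forall_congr' fun x => (isHomeomorph_toGIT_zero hK).homeomorph.eq_symm_apply.symm

end GIT

end ToricHyperkahler

open ToricHyperkahler in
theorem mainTheorem5_general (N : ℕ) (K : Subgroup (RealTorus N))
    (hclosed : IsClosed (K : Set (RealTorus N))) (α : KDual K) (β : KDualC K) :
    (IsMorphism (gitMap K α β) ∧ IsProperMap (gitMap K α β) ∧
      Function.Surjective (gitMap K α β)) ∧
    (∃! π₁ : X K α β → X K 0 β, IsNaturalMap K α β π₁) ∧
    (∀ π₁ : X K α β → X K 0 β, IsNaturalMap K α β π₁ →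
      IsProperMap π₁ ∧ Function.Surjective π₁) := by
  refine ⟨⟨isMorphism_gitMap, isProperMap_gitMap hclosed, surjective_gitMap⟩,
    ⟨_, (isNaturalMap_iff hclosed).2 rfl, fun _ => (isNaturalMap_iff hclosed).1⟩,
    fun π₁ hπ₁ => ?_⟩
  obtain rfl := (isNaturalMap_iff hclosed).1 hπ₁
  let e := (isHomeomorph_toGIT_zero (β := β) hclosed).homeomorph
  exact ⟨e.symm.isProperMap.comp (isProperMap_gitMap_comp_toGIT hclosed),
    e.symm.surjective.comp (surjective_gitMap.comp surjective_toGIT)⟩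

theorem mainTheorem5 (N : ℕ) (K : Subgroup (ToricHyperkahler.RealTorus N))
    (hclosed : IsClosed (K : Set (ToricHyperkahler.RealTorus N)))
    (hconn : IsConnected (K : Set (ToricHyperkahler.RealTorus N)))
    (α : ToricHyperkahler.KDual K) (β : ToricHyperkahler.KDualC K) :
    (ToricHyperkahler.IsMorphism (ToricHyperkahler.gitMap K α β) ∧
      IsProperMap (ToricHyperkahler.gitMap K α β) ∧
      Function.Surjective (ToricHyperkahler.gitMap K α β)) ∧
    (∃! π₁ : ToricHyperkahler.X K α β → ToricHyperkahler.X K 0 β,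
      ToricHyperkahler.IsNaturalMap K α β π₁) ∧
    (∀ π₁ : ToricHyperkahler.X K α β → ToricHyperkahler.X K 0 β,
      ToricHyperkahler.IsNaturalMap K α β π₁ →
        IsProperMap π₁ ∧ Function.Surjective π₁) :=
  mainTheorem5_general N K hclosed α β
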